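/- A strict poset is a set $A$ with an asymmetric transitive relation $<$; it is an antichain if no two elements are comparable. For $k\ge 1$ let $A^k$ carry the coordinatewise relation: $x<y$ iff $x_i<y_i$ for all $i$. A strict poset $\mathbf A=(A,<)$ is polymorphism-homogeneous if for every $k\ge 1$, every finite $D\subseteq A^k$ and every map $f:D\to A$ with $x<y\Rightarrow f(x)<f(y)$ for $x,y\in D$, there is a map $g:A^k\to A$ extending $f$ with $x<y\Rightarrow g(x)<g(y)$ for all $x,y\in A^k$. Let $\mathbb U$ be the countable universal homogeneous strict poset, i.e. the countable strict poset, unique up to isomorphism, into which every countable strict poset embeds and in which every isomorphism between finite induced subposets extends to an automorphism. By an extension of $\mathbb U$ we mean here a strict poset $(A,<)$ such that (i) there is a relation $\sqsubset$ on $A$, contained in $<$, with $(A,\sqsubset)\cong\mathbb U$; and (ii) $(A,<)$ is $X_5$-dense: whenever $a_1,a_2,a_3,a_4\in A$ (not necessarily distinct) satisfy $a_i<a_j$ for all $i\in\{1,2\}$, $j\in\{3,4\}$, there is $c\in A$ with $a_1,a_2<c<a_3,a_4$. **Theorem.** A countable (finite or countably infinite) strict poset is polymorphism-homogeneous if and only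 if it is an antichain or an extension of $\mathbb U$. -/

import Mathlib

namespace StrictPoset

/-- The relation of the direct power `(A, r)^k`: coordinatewise. -/
def powerRel {A : Type*} (k : ℕ) (r : A → A → Prop) : (Fin k → A) → (Fin k → A) → Prop :=
  fun x y => ∀ i, r (x i) (y i)

/-- `(A, r)` is `k`-polymorphism-homogeneous: every `k`-ary local polymorphism (a homomorphism to
`(A, r)` from the substructure of `(A, r)^k` induced on a finite set `D`) extends to a `k`-ary
polymorphism (a homomorphism from `(A, r)^k` to `(A, r)`). -/
def IsKPolymorphismHomogeneous {A : Type*} (k : ℕ) (r : A → A → Prop) : Prop :=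
  ∀ D : Set (Fin k → A), D.Finite →
    ∀ f : Subrel (powerRel k r) (· ∈ D) →r r,
      ∃ g : powerRel k r →r r, ∀ x : {x // x ∈ D}, g x.1 = f x

/-- `(A, r)` is polymorphism-homogeneous: `k`-polymorphism-homogeneous for every `k ≥ 1`. -/
def IsPolymorphismHomogeneous {A : Type*} (r : A → A → Prop) : Prop :=
  ∀ k : ℕ, 1 ≤ k → IsKPolymorphismHomogeneous k r

/-- `(A, r)` is homogeneous: every isomorphism between finite induced substructures extends to an
automorphism. -/
def IsHomogeneous {A : Type*} (r : A → A → Prop) : Prop :=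
  ∀ D E : Set A, D.Finite → E.Finite →
    ∀ f : Subrel r (· ∈ D) ≃r Subrel r (· ∈ E),
      ∃ g : r ≃r r, ∀ x : {x // x ∈ D}, g x.1 = (f x).1

/-- `(A, r)` is universal for countable strict posets: each of them embeds into it. -/
def IsUniversal {A : Type*} (r : A → A → Prop) : Prop :=
  ∀ (B : Type) (t : B → B → Prop), Countable B → IsStrictOrder B t → Nonempty (t ↪r r)

/-- `(A, r)` is (a copy of) the countable universal homogeneous strict poset, which is unique up
to isomorphism. -/
structure IsCountableUniversalHomogeneous {A : Type*} (r : A → A → Prop) : Prop where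
  countable : Countable A
  strictOrder : IsStrictOrder A r
  universal : IsUniversal r
  homogeneous : IsHomogeneous r

/-- `r` arises by adding comparabilities to an order on the same set that makes it a copy of the
countable universal homogeneous strict poset. -/
def IsOrderExtensionOfU {A : Type*} (r : A → A → Prop) : Prop :=
  ∃ s : A → A → Prop, IsCountableUniversalHomogeneous s ∧ ∀ x y, s x y → r x y

/-- `X₅`-density; the points `a₁, a₂` may coincide, and so may `a₃, a₄`. -/
def IsX5Dense {A : Type*} (r : A → A → Prop) : Prop :=
  ∀ a₁ a₂ a₃ a₄ : A, r a₁ a₃ → r a₁ a₄ → r a₂ a₃ → r a₂ a₄ →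
    ∃ c, r a₁ c ∧ r a₂ c ∧ r c a₃ ∧ r c a₄

/-- Extensions of the countable universal homogeneous strict poset, in the sense relevant to
homomorphism-homogeneity. Adding comparabilities to the universal homogeneous poset may create
covering pairs or unfilled bow-ties; the extensions meant are those without these, that is, the
`X₅`-dense ones. -/
def IsExtensionOfU {A : Type*} (r : A → A → Prop) : Prop :=
  IsOrderExtensionOfU r ∧ IsX5Dense r

end StrictPoset

namespace StrictPoset

/-! Everything passes through `HasInterpolation`. With interpolation, a finite local polymorphism
extends one argument at a time: the values forced below and above the new value are separated by
transitivity. Conversely, one comparable pair yields points below and above everything, and any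
finite `L < R` can be coded by vectors below and above a constant vector of a power; extending the
decoding map to that vector gives the interpolant.

An extension of U interpolates because U bounds every finite set on both sides and `X₅`-density
fills the gaps. Conversely, under interpolation a generic union of finite suborders of `r` realizes
every consistent one-point type, so it is a copy of U inside `r`. -/

/-- Rasiowa–Sikorski: a chain meeting countably many cofinal sets. -/
theorem exists_monotone_forall_exists {P ι : Type*} [Preorder P] [Countable ι] (p : P)
    (Q : ι → P → Prop) (h : ∀ i p, ∃ q, p ≤ q ∧ Q i q) :
    ∃ u : ℕ → P, Monotone u ∧ u 0 = p ∧ ∀ i, ∃ n, Q i (u n) := by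
  classical
  have := Encodable.ofCountable ι
  let 𝒟 : ι → Order.Cofinal P := fun i =>
    ⟨{q | Q i q}, fun x => by obtain ⟨q, h1, h2⟩ := h i x; exact ⟨q, h2, h1⟩⟩
  exact ⟨Order.sequenceOfCofinals p 𝒟, Order.sequenceOfCofinals.monotone p 𝒟, rfl,
    fun i => ⟨_, Order.sequenceOfCofinals.encode_mem p 𝒟 i⟩⟩

/-- Frame for all back-and-forth arguments: `X` consists of argument-value pairs, `C` says that two
pairs are compatible, `W i` that a pair meets the `i`-th demand. -/
theorem exists_clique {X ι : Type*} [Countable ι] (C : X → X → Prop) (W : ι → X → Prop)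
    (h : ∀ S : Finset X, (∀ p ∈ S, ∀ q ∈ S, C p q) → ∀ i, ∃ x, W i x ∧ C x x ∧
      ∀ p ∈ S, C p x ∧ C x p)
    (S : Finset X) (hS : ∀ p ∈ S, ∀ q ∈ S, C p q) :
    ∃ T : Set X, (∀ p ∈ S, p ∈ T) ∧ (∀ p ∈ T, ∀ q ∈ T, C p q) ∧ ∀ i, ∃ x ∈ T, W i x := by
  classical
  obtain ⟨u, hu, h0, hW⟩ := exists_monotone_forall_exists
    (P := {S : Finset X // ∀ p ∈ S, ∀ q ∈ S, C p q}) ⟨S, hS⟩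
    (fun i S => ∃ x ∈ S.1, W i x) (by
      rintro i ⟨S, hS⟩
      obtain ⟨x, hx, hxx, hxS⟩ := h S hS i
      refine ⟨⟨insert x S, ?_⟩, Finset.subset_insert _ _, x, Finset.mem_insert_self _ _, hx⟩
      intro p hp q hq
      rcases Finset.mem_insert.1 hp with hp | hp <;> rcases Finset.mem_insert.1 hq with hq | hq
      · exact hp ▸ hq ▸ hxx
      · exact hp ▸ (hxS _ hq).2
      · exact hq ▸ (hxS _ hp).1
      · exact hS _ hp _ hq)
  refine ⟨{x | ∃ n, x ∈ (u n).1}, fun p hp => ⟨0, by rw [h0]; exact hp⟩, ?_, fun i => ?_⟩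
  · rintro p ⟨m, hm⟩ q ⟨n, hn⟩
    exact (u (max m n)).2 _ (hu (le_max_left m n) hm) _ (hu (le_max_right m n) hn)
  · obtain ⟨n, x, hx, hi⟩ := hW i
    exact ⟨x, ⟨n, hx⟩, hi⟩

/-! ### Interpolation and polymorphism-homogeneity -/

/-- Between finite sets `L < R`, either of which may be empty, there is a point. -/
def HasInterpolation {A : Type*} (r : A → A → Prop) : Prop :=
  ∀ L R : Finset A, (∀ l ∈ L, ∀ u ∈ R, r l u) → ∃ c, (∀ l ∈ L, r l c) ∧ ∀ u ∈ R, r c u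

theorem HasInterpolation.isPolymorphismHomogeneous {A : Type*} [Countable A] {r : A → A → Prop}
    [IsStrictOrder A r] (h : HasInterpolation r) : IsPolymorphismHomogeneous r := by
  classical
  intro k hk D hD f
  have htrans : ∀ x y z : Fin k → A, powerRel k r x y → powerRel k r y z → powerRel k r x z :=
    fun x y z h1 h2 i => _root_.trans (h1 i) (h2 i)
  -- For `k = 0` the power would have a reflexive point; `1 ≤ k` excludes this.
  have hirr : ∀ x : Fin k → A, ¬ powerRel k r x x := fun x hx => irrefl _ (hx ⟨0, hk⟩)
  have := hD.fintype
  obtain ⟨T, hST, hC, hW⟩ := exists_clique (X := (Fin k → A) × A) (ι := Fin k → A)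
    (fun p q => (p.1 = q.1 → p.2 = q.2) ∧ (powerRel k r p.1 q.1 → r p.2 q.2))
    (fun i p => p.1 = i) (by
      intro S hS x
      by_cases hx : ∃ p ∈ S, p.1 = x
      · obtain ⟨p, hp, rfl⟩ := hx
        exact ⟨p, rfl, hS _ hp _ hp, fun q hq => ⟨hS _ hq _ hp, hS _ hp _ hq⟩⟩
      · push Not at hx
        obtain ⟨c, hL, hR⟩ := h ((S.filter fun p => powerRel k r p.1 x).image Prod.snd)
          ((S.filter fun p => powerRel k r x p.1).image Prod.snd) (by
            simp only [Finset.mem_image, Finset.mem_filter]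
            rintro _ ⟨p, ⟨hp, hpx⟩, rfl⟩ _ ⟨q, ⟨hq, hqx⟩, rfl⟩
            exact (hS _ hp _ hq).2 (htrans _ _ _ hpx hqx))
        refine ⟨(x, c), rfl, ⟨fun _ => rfl, fun hxx => absurd hxx (hirr x)⟩, fun p hp => ⟨⟨fun e =>
          absurd e (hx p hp), fun hpx => hL _ ?_⟩, fun e => absurd e.symm (hx p hp),
          fun hpx => hR _ ?_⟩⟩
        · exact Finset.mem_image_of_mem _ (Finset.mem_filter.2 ⟨hp, hpx⟩)
        · exact Finset.mem_image_of_mem _ (Finset.mem_filter.2 ⟨hp, hpx⟩))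
    (Finset.univ.image fun d : {x // x ∈ D} => (d.1, f d)) (by
      simp only [Finset.mem_image, Finset.mem_univ, true_and]
      rintro _ ⟨d, rfl⟩ _ ⟨e, rfl⟩
      exact ⟨fun hde => by rw [Subtype.ext hde], fun hde => f.map_rel hde⟩)
  choose g hgT hg using hW
  refine ⟨⟨fun x => (g x).2, fun {x y} hxy => (hC _ (hgT x) _ (hgT y)).2 ?_⟩, fun x => ?_⟩
  · rw [hg, hg]; exact hxy
  · exact (hC _ (hgT x) (x.1, f x) (hST _ (Finset.mem_image_of_mem _ (Finset.mem_univ x)))).1 (hg _)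

theorem isPolymorphismHomogeneous_of_isAntichain {A : Type*} {r : A → A → Prop} [IsStrictOrder A r]
    (h : IsAntichain r Set.univ) : IsPolymorphismHomogeneous r := by
  classical
  intro k hk D _ f
  have hr : ∀ x y, ¬ r x y := fun x y hxy => by
    rcases eq_or_ne x y with rfl | hne
    · exact irrefl x hxy
    · exact h (Set.mem_univ x) (Set.mem_univ y) hne hxy
  exact ⟨⟨fun x => if hx : x ∈ D then f ⟨x, hx⟩ else x ⟨0, hk⟩,
    fun {x y} hxy => absurd (hxy ⟨0, hk⟩) (hr _ _)⟩, fun x => dif_pos x.2⟩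

theorem IsPolymorphismHomogeneous.exists_extend {A : Type*} {r : A → A → Prop}
    (h : IsPolymorphismHomogeneous r) {k : ℕ} (hk : 1 ≤ k) {ι : Type*} [Finite ι]
    (d : ι → Fin k → A) (v : ι → A) (hd : Function.Injective d)
    (hv : ∀ i j, powerRel k r (d i) (d j) → r (v i) (v j)) :
    ∃ g : powerRel k r →r r, ∀ i, g (d i) = v i := by
  classical
  let e := Equiv.ofInjective d hd
  have he : ∀ x : {x // x ∈ Set.range d}, d (e.symm x) = x.1 := fun x =>
    Equiv.apply_ofInjective_symm hd x
  obtain ⟨g, hg⟩ := h k hk (Set.range d) (Set.finite_range d)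
    ⟨fun x => v (e.symm x), fun {x y} hxy => hv _ _ (by rw [he, he]; exact hxy)⟩
  refine ⟨g, fun i => (hg ⟨d i, i, rfl⟩).trans ?_⟩
  exact congrArg v (Equiv.ofInjective_symm_apply hd i)

/-- Any one-point map `z ↦ x` is a local polymorphism. Extending it with `z = b` sends `a` below
`x`; with `z = a` it sends `b` above `x`. -/
theorem IsPolymorphismHomogeneous.exists_lt_and_gt {A : Type*} {r : A → A → Prop}
    [IsStrictOrder A r] (h : IsPolymorphismHomogeneous r) {a b : A} (hab : r a b) (x : A) :
    (∃ y, r y x) ∧ ∃ y, r x y := by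
  have key : ∀ z : A, ∃ g : powerRel 1 r →r r, g (fun _ => z) = x := fun z => by
    obtain ⟨g, hg⟩ := h.exists_extend le_rfl (ι := Unit) (fun _ _ => z) (fun _ => x)
      (fun _ _ _ => rfl) (fun _ _ hh => absurd (hh 0) (irrefl z))
    exact ⟨g, hg ()⟩
  have hp : powerRel 1 r (fun _ => a) (fun _ => b) := fun _ => hab
  constructor
  · obtain ⟨g, hg⟩ := key b
    exact ⟨_, hg ▸ g.map_rel hp⟩
  · obtain ⟨g, hg⟩ := key a
    exact ⟨_, hg ▸ g.map_rel hp⟩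

/-- Take a chain `a₀ < a₁ < a < c₀ < c₁` and one coordinate per point of `L ∪ R`. A point of `L` is
coded by `a₁` at its own coordinate and `a₀` elsewhere, a point of `R` likewise by `c₁` and `c₀`.
Own coordinates prevent comparabilities within either side, so decoding is a local polymorphism. -/
theorem IsPolymorphismHomogeneous.hasInterpolation {A : Type*} {r : A → A → Prop}
    [IsStrictOrder A r] (h : IsPolymorphismHomogeneous r) {a b : A} (hab : r a b) :
    HasInterpolation r := by
  classical
  intro L R hLR
  have down := fun x => (h.exists_lt_and_gt hab x).1
  have up := fun x => (h.exists_lt_and_gt hab x).2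
  obtain ⟨a₁, h₁⟩ := down a
  obtain ⟨a₀, h₀⟩ := down a₁
  obtain ⟨c₀, h₂⟩ := up a
  obtain ⟨c₁, h₃⟩ := up c₀
  have tr : ∀ {x y z : A}, r x y → r y z → r x z := fun h1 h2 => _root_.trans h1 h2
  have ir : ∀ {x : A}, ¬ r x x := fun {x} => irrefl x
  have as : ∀ {x y : A}, r x y → ¬ r y x := fun h1 h2 => ir (tr h1 h2)
  rcases (L ∪ R).eq_empty_or_nonempty with hS | hS
  · obtain ⟨rfl, rfl⟩ := Finset.union_eq_empty.1 hS
    exact ⟨a, by simp, by simp⟩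
  let e := (L ∪ R).equivFin
  have hdisj : ∀ x ∈ L, x ∉ R := fun x hx hx' => ir (hLR x hx x hx')
  let d : {x // x ∈ L ∪ R} → Fin (L ∪ R).card → A := fun s i =>
    if s.1 ∈ L then (if i = e s then a₁ else a₀) else (if i = e s then c₁ else c₀)
  have dL : ∀ s, s.1 ∈ L → ∀ i, d s i = if i = e s then a₁ else a₀ := fun s hs i => if_pos hs
  have dR : ∀ s, s.1 ∉ L → ∀ i, d s i = if i = e s then c₁ else c₀ := fun s hs i => if_neg hs
  have dlt : ∀ s, s.1 ∈ L → ∀ i, r (d s i) a := by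
    intro s hs i
    rw [dL s hs]
    split_ifs
    · exact h₁
    · exact tr h₀ h₁
  have dgt : ∀ s, s.1 ∉ L → ∀ i, r a (d s i) := by
    intro s hs i
    rw [dR s hs]
    split_ifs
    · exact tr h₂ h₃
    · exact h₂
  have ne₁ : a₁ ≠ a₀ := fun hh => ir (hh ▸ h₀)
  have ne₂ : c₁ ≠ c₀ := fun hh => ir (hh ▸ h₃)
  obtain ⟨g, hg⟩ := h.exists_extend hS.card_pos d Subtype.val (by
      intro s t hst
      by_cases hs : s.1 ∈ L <;> by_cases ht : t.1 ∈ L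
      · by_contra hne
        have := congrFun hst (e s)
        rw [dL s hs, dL t ht, if_pos rfl, if_neg (fun hh => hne (e.injective hh))] at this
        exact ne₁ this
      · exact absurd (dgt t ht (e s)) (as (hst ▸ dlt s hs (e s)))
      · exact absurd (dgt s hs (e s)) (as (hst ▸ dlt t ht (e s)))
      · by_contra hne
        have := congrFun hst (e s)
        rw [dR s hs, dR t ht, if_pos rfl, if_neg (fun hh => hne (e.injective hh))] at this
        exact ne₂ this) (by
      intro s t hst
      by_cases hs : s.1 ∈ L <;> by_cases ht : t.1 ∈ L
      · have := hst (e s)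
        rw [dL s hs, dL t ht, if_pos rfl] at this
        split_ifs at this
        · exact absurd this ir
        · exact absurd h₀ (as this)
      · exact hLR _ hs _ ((Finset.mem_union.1 t.2).resolve_left ht)
      · exact absurd (tr (dgt s hs (e s)) (tr (hst (e s)) (dlt t ht (e s)))) ir
      · have := hst (e s)
        rw [dR s hs, dR t ht, if_pos rfl] at this
        split_ifs at this
        · exact absurd this ir
        · exact absurd h₃ (as this))
  refine ⟨g fun _ => a, fun l hl => ?_, fun u hu => ?_⟩
  · have := g.map_rel (a := d ⟨l, Finset.mem_union_left _ hl⟩) (b := fun _ => a) (dlt _ hl)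
    rwa [hg] at this
  · have := g.map_rel (b := d ⟨u, Finset.mem_union_right _ hu⟩) (a := fun _ => a)
      (dgt _ fun hl => hdisj _ hl hu)
    rwa [hg] at this

/-! ### Interpolation in extensions of U -/

theorem IsCountableUniversalHomogeneous.exists_bounds {A : Type*} {s : A → A → Prop}
    (h : IsCountableUniversalHomogeneous s) (F : Finset A) :
    ∃ b c, ∀ x ∈ F, s b x ∧ s x c := by
  classical
  have := h.strictOrder
  -- `IsUniversal` concerns orders in `Type`, so `F` is copied onto `Fin F.card`; `inr false` and
  -- `inr true` become a new bottom and top. Homogeneity then moves the embedded copy back onto `F`.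
  let e := F.equivFin
  let v : Fin F.card → A := fun i => (e.symm i).1
  let t : Fin F.card ⊕ Bool → Fin F.card ⊕ Bool → Prop
    | .inl i, .inl j => s (v i) (v j)
    | .inl _, .inr b => b = true
    | .inr b, .inl _ => b = false
    | .inr b, .inr c => b = false ∧ c = true
  have ht : IsStrictOrder (Fin F.card ⊕ Bool) t :=
    { irrefl := by
        rintro (i | b) hh
        · exact irrefl (r := s) _ hh
        · exact absurd (hh.1.symm.trans hh.2) (by decide)
      trans := by
        rintro (i | b) (j | c) (k | d) h1 h2 <;> simp only [t] at h1 h2 ⊢ <;>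
          first
            | exact _root_.trans h1 h2
            | simp_all }
  obtain ⟨φ⟩ := h.universal _ t inferInstance ht
  let D := Set.range fun i => φ (.inl i)
  have hφ : Function.Injective fun i => φ (.inl i) := fun i j hij => Sum.inl_injective (φ.injective hij)
  let ψ := Equiv.ofInjective _ hφ
  obtain ⟨g, hg⟩ := h.homogeneous D (F : Set A) (Set.finite_range _) F.finite_toSet
    ⟨ψ.symm.trans e.symm, by
      intro x y
      obtain ⟨i, rfl⟩ := ψ.surjective x
      obtain ⟨j, rfl⟩ := ψ.surjective y
      simp only [Equiv.trans_apply, Equiv.symm_apply_apply]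
      exact (φ.map_rel_iff (a := .inl i) (b := .inl j)).symm⟩
  have hgv : ∀ x : {x // x ∈ F}, g (φ (.inl (e x))) = x.1 := fun x => by
    refine (hg (ψ (e x))).trans ?_
    change (e.symm (ψ.symm (ψ (e x)))).1 = x.1
    simp
  refine ⟨g (φ (.inr false)), g (φ (.inr true)), fun x hx => ?_⟩
  have hx' := hgv ⟨x, hx⟩
  dsimp only at hx'
  rw [← hx', g.map_rel_iff, g.map_rel_iff, φ.map_rel_iff, φ.map_rel_iff]
  exact ⟨rfl, rfl⟩

/-- Under two fixed upper points, lower points are absorbed one by one into a single interpolant;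
then the same is done with the upper points. -/
theorem IsX5Dense.exists_between {A : Type*} {r : A → A → Prop} [IsStrictOrder A r] (h : IsX5Dense r)
    {L R : Finset A} (hL : L.Nonempty) (hR : R.Nonempty) (hLR : ∀ l ∈ L, ∀ u ∈ R, r l u) :
    ∃ c, (∀ l ∈ L, r l c) ∧ ∀ u ∈ R, r c u := by
  classical
  have two : ∀ L : Finset A, L.Nonempty → ∀ u v, (∀ l ∈ L, r l u ∧ r l v) →
      ∃ c, (∀ l ∈ L, r l c) ∧ r c u ∧ r c v := by
    intro L hL u v
    induction hL using Finset.Nonempty.cons_induction with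
    | singleton a =>
      intro hl
      have := hl a (Finset.mem_singleton_self a)
      obtain ⟨c, h1, -, h3, h4⟩ := h a a u v this.1 this.2 this.1 this.2
      exact ⟨c, by simpa using h1, h3, h4⟩
    | cons a s ha hs ih =>
      intro hl
      obtain ⟨c, h1, h2, h3⟩ := ih fun l hls => hl l (Finset.mem_cons_of_mem hls)
      have := hl a (Finset.mem_cons_self a s)
      obtain ⟨d, h4, h5, h6, h7⟩ := h a c u v this.1 this.2 h2 h3
      refine ⟨d, fun l hls => ?_, h6, h7⟩
      rcases Finset.mem_cons.1 hls with rfl | hls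
      · exact h4
      · exact _root_.trans (h1 l hls) h5
  induction hR using Finset.Nonempty.cons_induction with
  | singleton u =>
    obtain ⟨c, h1, h2, -⟩ := two L hL u u fun l hl =>
      ⟨hLR l hl u (Finset.mem_singleton_self u), hLR l hl u (Finset.mem_singleton_self u)⟩
    exact ⟨c, h1, by simpa using h2⟩
  | cons u s hu hs ih =>
    obtain ⟨c, h1, h2⟩ := ih fun l hl v hv => hLR l hl v (Finset.mem_cons_of_mem hv)
    obtain ⟨d, h3, h4, h5⟩ := two L hL u c fun l hl =>
      ⟨hLR l hl u (Finset.mem_cons_self u s), h1 l hl⟩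
    refine ⟨d, h3, fun v hv => ?_⟩
    rcases Finset.mem_cons.1 hv with rfl | hv
    · exact h4
    · exact _root_.trans h5 (h2 v hv)

theorem IsExtensionOfU.hasInterpolation {A : Type*} {r : A → A → Prop} [IsStrictOrder A r]
    (h : IsExtensionOfU r) : HasInterpolation r := by
  obtain ⟨⟨s, hs, hsr⟩, hX⟩ := h
  intro L R hLR
  rcases L.eq_empty_or_nonempty with rfl | hL
  · obtain ⟨b, _, hb⟩ := hs.exists_bounds R
    exact ⟨b, by simp, fun u hu => hsr _ _ (hb u hu).1⟩
  rcases R.eq_empty_or_nonempty with rfl | hR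
  · obtain ⟨_, c, hc⟩ := hs.exists_bounds L
    exact ⟨c, fun l hl => hsr _ _ (hc l hl).2, by simp⟩
  exact hX.exists_between hL hR hLR

theorem HasInterpolation.isX5Dense {A : Type*} {r : A → A → Prop} (h : HasInterpolation r) :
    IsX5Dense r := by
  classical
  intro a b c d h1 h2 h3 h4
  obtain ⟨x, hL, hR⟩ := h {a, b} {c, d} (by simp; exact ⟨⟨h1, h2⟩, h3, h4⟩)
  simp at hL hR
  exact ⟨x, hL.1, hL.2, hR.1, hR.2⟩

/-! ### The extension property gives universality and homogeneity -/

/-- Every one-point extension type over a finite set that is consistent with a strict order is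
realized: there is a point above `L`, below `R` and incomparable to `I`. -/
def HasExtensionProperty {A : Type*} (s : A → A → Prop) : Prop :=
  ∀ L R I : Finset A, (∀ l ∈ L, ∀ u ∈ R, s l u) → (∀ i ∈ I, ∀ l ∈ L, i ≠ l ∧ ¬ s i l) →
    (∀ i ∈ I, ∀ u ∈ R, i ≠ u ∧ ¬ s u i) →
    ∃ c, c ∉ I ∧ (∀ l ∈ L, s l c) ∧ (∀ u ∈ R, s c u) ∧ ∀ i ∈ I, ¬ s i c ∧ ¬ s c i

/-- The pairs `p`, `q` agree about equality and about the relations `t` and `s`. -/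
def PairIso {B A : Type*} (t : B → B → Prop) (s : A → A → Prop) (p q : B × A) : Prop :=
  (p.1 = q.1 ↔ p.2 = q.2) ∧ (t p.1 q.1 ↔ s p.2 q.2)

theorem HasExtensionProperty.exists_pairIso {B A : Type*} {t : B → B → Prop} {s : A → A → Prop}
    [IsStrictOrder B t] [IsStrictOrder A s] (h : HasExtensionProperty s) (S : Finset (B × A))
    (hS : ∀ p ∈ S, ∀ q ∈ S, PairIso t s p q) (b : B) :
    ∃ x : B × A, x.1 = b ∧ PairIso t s x x ∧ ∀ p ∈ S, PairIso t s p x ∧ PairIso t s x p := by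
  classical
  by_cases hb : ∃ p ∈ S, p.1 = b
  · obtain ⟨p, hp, rfl⟩ := hb
    exact ⟨p, rfl, hS _ hp _ hp, fun q hq => ⟨hS _ hq _ hp, hS _ hp _ hq⟩⟩
  push Not at hb
  obtain ⟨c, hcI, hL, hR, hI⟩ := h ((S.filter fun p => t p.1 b).image Prod.snd)
    ((S.filter fun p => t b p.1).image Prod.snd)
    ((S.filter fun p => ¬ t p.1 b ∧ ¬ t b p.1).image Prod.snd) (by
      simp only [Finset.mem_image, Finset.mem_filter]
      rintro _ ⟨p, ⟨hp, hpx⟩, rfl⟩ _ ⟨q, ⟨hq, hqx⟩, rfl⟩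
      exact (hS _ hp _ hq).2.1 (_root_.trans hpx hqx)) (by
      simp only [Finset.mem_image, Finset.mem_filter]
      rintro _ ⟨p, ⟨hp, hpx⟩, rfl⟩ _ ⟨q, ⟨hq, hqx⟩, rfl⟩
      exact ⟨fun e => hpx.1 ((hS _ hp _ hq).1.2 e ▸ hqx),
        fun e => hpx.1 (_root_.trans ((hS _ hp _ hq).2.2 e) hqx)⟩) (by
      simp only [Finset.mem_image, Finset.mem_filter]
      rintro _ ⟨p, ⟨hp, hpx⟩, rfl⟩ _ ⟨q, ⟨hq, hqx⟩, rfl⟩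
      exact ⟨fun e => hpx.2 ((hS _ hp _ hq).1.2 e ▸ hqx),
        fun e => hpx.2 (_root_.trans hqx ((hS _ hq _ hp).2.2 e))⟩)
  have irB : ∀ x : B, ¬ t x x := fun x => irrefl x
  have irA : ∀ x : A, ¬ s x x := fun x => irrefl x
  have asB : ∀ {x y : B}, t x y → ¬ t y x := fun h1 h2 => irB _ (_root_.trans h1 h2)
  have asA : ∀ {x y : A}, s x y → ¬ s y x := fun h1 h2 => irA _ (_root_.trans h1 h2)
  have key : ∀ p ∈ S, p.2 ≠ c ∧ (t p.1 b ↔ s p.2 c) ∧ (t b p.1 ↔ s c p.2) := by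
    intro p hp
    by_cases h1 : t p.1 b
    · have := hL p.2 (Finset.mem_image_of_mem _ (Finset.mem_filter.2 ⟨hp, h1⟩))
      exact ⟨fun e => irA c (e ▸ this), iff_of_true h1 this, iff_of_false (asB h1) (asA this)⟩
    by_cases h2 : t b p.1
    · have := hR p.2 (Finset.mem_image_of_mem _ (Finset.mem_filter.2 ⟨hp, h2⟩))
      exact ⟨fun e => irA c (e ▸ this), iff_of_false (asB h2) (asA this), iff_of_true h2 this⟩
    · have hmem := Finset.mem_image_of_mem Prod.snd
        (Finset.mem_filter (p := fun p => ¬ t p.1 b ∧ ¬ t b p.1).2 ⟨hp, h1, h2⟩)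
      exact ⟨fun e => hcI (e ▸ hmem), iff_of_false h1 (hI _ hmem).1, iff_of_false h2 (hI _ hmem).2⟩
  refine ⟨(b, c), rfl, ⟨iff_of_true rfl rfl, iff_of_false (irB b) (irA c)⟩, fun p hp => ?_⟩
  obtain ⟨h1, h2, h3⟩ := key p hp
  exact ⟨⟨iff_of_false (hb p hp) h1, h2⟩, ⟨iff_of_false (Ne.symm (hb p hp)) (Ne.symm h1), h3⟩⟩

theorem HasExtensionProperty.isUniversal {A : Type*} {s : A → A → Prop} [IsStrictOrder A s]
    (h : HasExtensionProperty s) : IsUniversal s := by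
  intro B t _ _
  obtain ⟨T, -, hC, hW⟩ := exists_clique (PairIso t s) (fun (b : B) x => x.1 = b)
    (fun S hS b => h.exists_pairIso S hS b) ∅ (by simp)
  choose g hgT hg using hW
  refine ⟨⟨⟨fun b => (g b).2, fun a b hab => ?_⟩, fun {a b} => ?_⟩⟩
  · have := (hC _ (hgT a) _ (hgT b)).1.2 hab
    rwa [hg, hg] at this
  · have := (hC _ (hgT a) _ (hgT b)).2
    rw [hg, hg] at this
    exact this.symm

theorem HasExtensionProperty.isHomogeneous {A : Type*} [Countable A] {s : A → A → Prop}
    [IsStrictOrder A s] (h : HasExtensionProperty s) : IsHomogeneous s := by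
  classical
  intro D E hD _ f
  have := hD.fintype
  obtain ⟨T, hST, hC, hW⟩ := exists_clique (PairIso s s)
    -- `inl` demands are the forth steps, `inr` demands the back steps, reduced to forth by swapping
    -- pairs.
    (fun (i : A ⊕ A) x => i.elim (fun a => x.1 = a) (fun a => x.2 = a)) (by
      rintro S hS (a | a)
      · exact h.exists_pairIso S hS a
      · obtain ⟨x, h1, h2, h3⟩ := h.exists_pairIso (t := s) (S.image Prod.swap) (by
          simp only [Finset.mem_image]
          rintro _ ⟨p, hp, rfl⟩ _ ⟨q, hq, rfl⟩
          exact ⟨(hS p hp q hq).1.symm, (hS p hp q hq).2.symm⟩) a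
        refine ⟨x.swap, h1, ⟨h2.1.symm, h2.2.symm⟩, fun p hp => ?_⟩
        obtain ⟨h4, h5⟩ := h3 _ (Finset.mem_image_of_mem _ hp)
        exact ⟨⟨h4.1.symm, h4.2.symm⟩, ⟨h5.1.symm, h5.2.symm⟩⟩)
    (Finset.univ.image fun d : {x // x ∈ D} => (d.1, (f d).1)) (by
      simp only [Finset.mem_image, Finset.mem_univ, true_and]
      rintro _ ⟨d, rfl⟩ _ ⟨e, rfl⟩
      refine ⟨?_, (f.map_rel_iff (a := d) (b := e)).symm⟩
      rw [Subtype.coe_inj, Subtype.coe_inj, f.injective.eq_iff])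
  choose g hgT hg using fun a => hW (.inl a)
  choose k hkT hk using fun a => hW (.inr a)
  simp only [Sum.elim_inl, Sum.elim_inr] at hg hk
  refine ⟨⟨⟨fun a => (g a).2, fun a => (k a).1, fun a => ?_, fun a => ?_⟩, fun {a b} => ?_⟩,
    fun x => ?_⟩
  · exact ((hC _ (hkT _) _ (hgT a)).1.2 (hk _)).trans (hg a)
  · exact ((hC _ (hgT _) _ (hkT a)).1.1 (hg _)).trans (hk a)
  · have := (hC _ (hgT a) _ (hgT b)).2
    rw [hg, hg] at this
    exact this.symm
  · exact (hC _ (hgT x) _ (hST _ (Finset.mem_image_of_mem _ (Finset.mem_univ x)))).1.1 (hg _)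

/-! ### A generic copy of U inside an interpolating order -/

/-- A strict order on a finite subset, contained in `r`. -/
structure FiniteSuborder {A : Type*} (r : A → A → Prop) where
  carrier : Finset A
  rel : A → A → Prop
  irrefl : ∀ x, ¬ rel x x
  trans : ∀ x y z, rel x y → rel y z → rel x z
  mem_left : ∀ x y, rel x y → x ∈ carrier
  mem_right : ∀ x y, rel x y → y ∈ carrier
  le : ∀ x y, rel x y → r x y

/-- Extensions are induced, so incomparabilities once decided also persist. -/
instance {A : Type*} (r : A → A → Prop) : Preorder (FiniteSuborder r) where
  le p q := p.carrier ⊆ q.carrier ∧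
    ∀ x ∈ p.carrier, ∀ y ∈ p.carrier, p.rel x y ↔ q.rel x y
  le_refl _ := ⟨subset_rfl, fun _ _ _ _ => Iff.rfl⟩
  le_trans _ _ _ h₁ h₂ := ⟨h₁.1.trans h₂.1, fun x hx y hy =>
    (h₁.2 x hx y hy).trans (h₂.2 x (h₁.1 hx) y (h₁.1 hy))⟩

theorem HasInterpolation.exists_notMem {A : Type*} {r : A → A → Prop} [IsStrictOrder A r]
    (h : HasInterpolation r) (F L R : Finset A) (hLR : ∀ l ∈ L, ∀ u ∈ R, r l u) :
    ∃ c, c ∉ F ∧ (∀ l ∈ L, r l c) ∧ ∀ u ∈ R, r c u := by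
  classical
  induction F using Finset.induction_on generalizing R with
  | empty =>
    obtain ⟨c, h1, h2⟩ := h L R hLR
    exact ⟨c, by simp, h1, h2⟩
  | insert a F _ ih =>
    -- If `a` lies above `L`, placing it in `R` forces `c < a`; otherwise no point above `L` can be
    -- `a`.
    by_cases ha : ∀ l ∈ L, r l a
    · obtain ⟨c, h1, h2, h3⟩ := ih (insert a R) fun l hl u hu => by
        rcases Finset.mem_insert.1 hu with rfl | hu
        · exact ha l hl
        · exact hLR l hl u hu
      refine ⟨c, fun hc => ?_, h2, fun u hu => h3 u (Finset.mem_insert_of_mem hu)⟩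
      rcases Finset.mem_insert.1 hc with rfl | hc
      · exact irrefl c (h3 c (Finset.mem_insert_self _ _))
      · exact h1 hc
    · obtain ⟨c, h1, h2, h3⟩ := ih R hLR
      refine ⟨c, fun hc => ?_, h2, h3⟩
      rcases Finset.mem_insert.1 hc with rfl | hc
      · exact ha h2
      · exact h1 hc

/-- Add points to the carrier, incomparable to everything. -/
def FiniteSuborder.addIsolated {A : Type*} {r : A → A → Prop} [DecidableEq A]
    (p : FiniteSuborder r) (F : Finset A) : FiniteSuborder r :=
  { p with
    carrier := p.carrier ∪ F
    mem_left := fun x y h => Finset.mem_union_left _ (p.mem_left x y h)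
    mem_right := fun x y h => Finset.mem_union_left _ (p.mem_right x y h) }

/-- A fresh `c` interpolates, in `r`, the down-closure `L'` of `L` and the up-closure `R'` of `R`.
Adding only `L' < c < R'` is already transitive, and `I` misses both closures. -/
theorem FiniteSuborder.exists_realize {A : Type*} {r : A → A → Prop} [IsStrictOrder A r]
    (h : HasInterpolation r) (p : FiniteSuborder r) (L R I : Finset A)
    (hL : L ⊆ p.carrier) (hR : R ⊆ p.carrier) (hI : I ⊆ p.carrier)
    (hLR : ∀ l ∈ L, ∀ u ∈ R, p.rel l u) (hIL : ∀ i ∈ I, ∀ l ∈ L, i ≠ l ∧ ¬ p.rel i l)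
    (hIR : ∀ i ∈ I, ∀ u ∈ R, i ≠ u ∧ ¬ p.rel u i) :
    ∃ q, p ≤ q ∧ ∃ c ∈ q.carrier, c ∉ I ∧ (∀ l ∈ L, q.rel l c) ∧ (∀ u ∈ R, q.rel c u) ∧
      ∀ i ∈ I, ¬ q.rel i c ∧ ¬ q.rel c i := by
  classical
  let L' := p.carrier.filter fun x => x ∈ L ∨ ∃ l ∈ L, p.rel x l
  let R' := p.carrier.filter fun x => x ∈ R ∨ ∃ u ∈ R, p.rel u x
  have hL' : ∀ {x}, x ∈ L' ↔ x ∈ p.carrier ∧ (x ∈ L ∨ ∃ l ∈ L, p.rel x l) := Finset.mem_filter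
  have hR' : ∀ {x}, x ∈ R' ↔ x ∈ p.carrier ∧ (x ∈ R ∨ ∃ u ∈ R, p.rel u x) := Finset.mem_filter
  have hLR' : ∀ l ∈ L', ∀ u ∈ R', p.rel l u := by
    intro l hl u hu
    rcases (hL'.1 hl).2 with h1 | ⟨l', h1, h2⟩ <;> rcases (hR'.1 hu).2 with h3 | ⟨u', h3, h4⟩
    · exact hLR _ h1 _ h3
    · exact p.trans _ _ _ (hLR _ h1 _ h3) h4
    · exact p.trans _ _ _ h2 (hLR _ h1 _ h3)
    · exact p.trans _ _ _ h2 (p.trans _ _ _ (hLR _ h1 _ h3) h4)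
  have down : ∀ x y, p.rel x y → y ∈ L' → x ∈ L' := by
    intro x y hxy hy
    refine hL'.2 ⟨p.mem_left _ _ hxy, Or.inr ?_⟩
    rcases (hL'.1 hy).2 with h1 | ⟨l', h1, h2⟩
    · exact ⟨y, h1, hxy⟩
    · exact ⟨l', h1, p.trans _ _ _ hxy h2⟩
  have up : ∀ x y, p.rel x y → x ∈ R' → y ∈ R' := by
    intro x y hxy hx
    refine hR'.2 ⟨p.mem_right _ _ hxy, Or.inr ?_⟩
    rcases (hR'.1 hx).2 with h1 | ⟨l', h1, h2⟩
    · exact ⟨x, h1, hxy⟩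
    · exact ⟨l', h1, p.trans _ _ _ h2 hxy⟩
  obtain ⟨c, hc, hLc, hcR⟩ := h.exists_notMem p.carrier L' R' fun l hl u hu =>
    p.le _ _ (hLR' l hl u hu)
  have hcL' : c ∉ L' := fun hh => hc (hL'.1 hh).1
  have hcR' : c ∉ R' := fun hh => hc (hR'.1 hh).1
  have hc₁ : ∀ x, ¬ p.rel c x := fun x hx => hc (p.mem_left _ _ hx)
  have hc₂ : ∀ x, ¬ p.rel x c := fun x hx => hc (p.mem_right _ _ hx)
  have hILR : ∀ i ∈ I, i ≠ c ∧ i ∉ L' ∧ i ∉ R' := by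
    refine fun i hi => ⟨fun e => hc (e ▸ hI hi), fun hh => ?_, fun hh => ?_⟩
    · rcases (hL'.1 hh).2 with h1 | ⟨l, h1, h2⟩
      · exact (hIL i hi i h1).1 rfl
      · exact (hIL i hi l h1).2 h2
    · rcases (hR'.1 hh).2 with h1 | ⟨l, h1, h2⟩
      · exact (hIR i hi i h1).1 rfl
      · exact (hIR i hi l h1).2 h2
  let q : FiniteSuborder r :=
    { carrier := insert c p.carrier
      rel := fun x y => p.rel x y ∨ (x ∈ L' ∧ y = c) ∨ (x = c ∧ y ∈ R')
      irrefl := by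
        rintro x (h1 | ⟨h1, rfl⟩ | ⟨rfl, h1⟩)
        · exact p.irrefl x h1
        · exact hcL' h1
        · exact hcR' h1
      trans := by
        rintro x y z (h1 | ⟨h1, rfl⟩ | ⟨rfl, h1⟩) (h2 | ⟨h2, rfl⟩ | ⟨h2', h2⟩)
        · exact Or.inl (p.trans _ _ _ h1 h2)
        · exact Or.inr (Or.inl ⟨down _ _ h1 h2, rfl⟩)
        · exact absurd (h2' ▸ h1) (hc₂ x)
        · exact absurd h2 (hc₁ z)
        · exact absurd h2 hcL'
        · exact Or.inl (hLR' _ h1 _ h2)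
        · exact Or.inr (Or.inr ⟨rfl, up _ _ h2 h1⟩)
        · exact absurd (hLR' _ h2 _ h1) (p.irrefl y)
        · exact absurd (h2' ▸ h1) hcR'
      mem_left := by
        rintro x y (h1 | ⟨h1, rfl⟩ | ⟨rfl, h1⟩)
        · exact Finset.mem_insert_of_mem (p.mem_left _ _ h1)
        · exact Finset.mem_insert_of_mem (hL'.1 h1).1
        · exact Finset.mem_insert_self _ _
      mem_right := by
        rintro x y (h1 | ⟨h1, rfl⟩ | ⟨rfl, h1⟩)
        · exact Finset.mem_insert_of_mem (p.mem_right _ _ h1)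
        · exact Finset.mem_insert_self _ _
        · exact Finset.mem_insert_of_mem (hR'.1 h1).1
      le := by
        rintro x y (h1 | ⟨h1, rfl⟩ | ⟨rfl, h1⟩)
        · exact p.le _ _ h1
        · exact hLc _ h1
        · exact hcR _ h1 }
  refine ⟨q, ⟨Finset.subset_insert _ _, fun x hx y hy => ⟨Or.inl, ?_⟩⟩, c,
    Finset.mem_insert_self _ _, fun hcI => (hILR c hcI).1 rfl,
    fun l hl => Or.inr (Or.inl ⟨hL'.2 ⟨hL hl, Or.inl hl⟩, rfl⟩),
    fun u hu => Or.inr (Or.inr ⟨rfl, hR'.2 ⟨hR hu, Or.inl hu⟩⟩), fun i hi => ⟨?_, ?_⟩⟩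
  · rintro (h1 | ⟨-, rfl⟩ | ⟨rfl, -⟩)
    · exact h1
    · exact absurd hy hc
    · exact absurd hx hc
  · rintro (h1 | ⟨h1, -⟩ | ⟨h1, -⟩)
    · exact hc₂ _ h1
    · exact (hILR i hi).2.1 h1
    · exact (hILR i hi).1 h1
  · rintro (h1 | ⟨-, h1⟩ | ⟨-, h1⟩)
    · exact hc₁ _ h1
    · exact (hILR i hi).1 h1
    · exact (hILR i hi).2.2 h1

theorem HasInterpolation.isOrderExtensionOfU {A : Type*} [Countable A] {r : A → A → Prop}
    [IsStrictOrder A r] (h : HasInterpolation r) : IsOrderExtensionOfU r := by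
  classical
  obtain ⟨u, hu, -, hQ⟩ := exists_monotone_forall_exists
    (P := FiniteSuborder r) (ι := Finset A × Finset A × Finset A)
    ⟨∅, fun _ _ => False, by simp, by simp, by simp, by simp, by simp⟩
    -- The type's consistency is judged at a stage containing all its points, where the answer is
    -- final.
    (fun i p => i.1 ∪ i.2.1 ∪ i.2.2 ⊆ p.carrier ∧ ((∀ l ∈ i.1, ∀ u ∈ i.2.1, p.rel l u) →
      (∀ x ∈ i.2.2, ∀ l ∈ i.1, x ≠ l ∧ ¬ p.rel x l) →
      (∀ x ∈ i.2.2, ∀ u ∈ i.2.1, x ≠ u ∧ ¬ p.rel u x) →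
      ∃ c ∈ p.carrier, c ∉ i.2.2 ∧ (∀ l ∈ i.1, p.rel l c) ∧ (∀ u ∈ i.2.1, p.rel c u) ∧
        ∀ x ∈ i.2.2, ¬ p.rel x c ∧ ¬ p.rel c x)) (by
      rintro ⟨L, R, I⟩ p
      let p' := p.addIsolated (L ∪ R ∪ I)
      have hpp' : p ≤ p' := ⟨Finset.subset_union_left, fun _ _ _ _ => Iff.rfl⟩
      have hsub : L ∪ R ∪ I ⊆ p'.carrier := Finset.subset_union_right
      have hL : L ⊆ p'.carrier := fun x hx => hsub (by simp [hx])
      have hR : R ⊆ p'.carrier := fun x hx => hsub (by simp [hx])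
      have hI : I ⊆ p'.carrier := fun x hx => hsub (by simp [hx])
      by_cases hv : (∀ l ∈ L, ∀ u ∈ R, p'.rel l u) ∧ (∀ i ∈ I, ∀ l ∈ L, i ≠ l ∧ ¬ p'.rel i l) ∧
        (∀ i ∈ I, ∀ u ∈ R, i ≠ u ∧ ¬ p'.rel u i)
      · obtain ⟨q, hq, hc⟩ := p'.exists_realize h L R I hL hR hI hv.1 hv.2.1 hv.2.2
        exact ⟨q, hpp'.trans hq, hsub.trans hq.1, fun _ _ _ => hc⟩
      · exact ⟨p', hpp', hsub, fun h1 h2 h3 => absurd ⟨h1, h2, h3⟩ hv⟩)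
  let s : A → A → Prop := fun x y => ∃ n, (u n).rel x y
  have hs : ∀ n, ∀ x ∈ (u n).carrier, ∀ y ∈ (u n).carrier, s x y ↔ (u n).rel x y := by
    refine fun n x hx y hy => ⟨?_, fun hh => ⟨n, hh⟩⟩
    rintro ⟨m, hm⟩
    rcases le_total m n with hmn | hmn
    · exact ((hu hmn).2 x ((u m).mem_left _ _ hm) y ((u m).mem_right _ _ hm)).1 hm
    · exact ((hu hmn).2 x hx y hy).2 hm
  have hord : IsStrictOrder A s :=
    { irrefl := fun x ⟨n, hn⟩ => (u n).irrefl x hn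
      trans := fun x y z ⟨m, hm⟩ ⟨n, hn⟩ => by
        have h1 := (hu (le_max_left m n)).2 x ((u m).mem_left _ _ hm) y ((u m).mem_right _ _ hm)
        have h2 := (hu (le_max_right m n)).2 y ((u n).mem_left _ _ hn) z ((u n).mem_right _ _ hn)
        exact ⟨max m n, (u _).trans _ _ _ (h1.1 hm) (h2.1 hn)⟩ }
  have hext : HasExtensionProperty s := by
    intro L R I h1 h2 h3
    obtain ⟨n, hsub, hn⟩ := hQ (L, R, I)
    dsimp only at hsub hn
    have hL : ∀ x ∈ L, x ∈ (u n).carrier := fun x hx => hsub (by simp [hx])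
    have hR : ∀ x ∈ R, x ∈ (u n).carrier := fun x hx => hsub (by simp [hx])
    have hI : ∀ x ∈ I, x ∈ (u n).carrier := fun x hx => hsub (by simp [hx])
    obtain ⟨c, hc, h4, h5, h6, h7⟩ := hn
      (fun l hl v hv => (hs n l (hL l hl) v (hR v hv)).1 (h1 l hl v hv))
      (fun i hi l hl => ⟨(h2 i hi l hl).1, fun hh => (h2 i hi l hl).2 ⟨n, hh⟩⟩)
      (fun i hi l hl => ⟨(h3 i hi l hl).1, fun hh => (h3 i hi l hl).2 ⟨n, hh⟩⟩)
    refine ⟨c, h4, fun l hl => ⟨n, h5 l hl⟩, fun v hv => ⟨n, h6 v hv⟩, fun i hi => ?_⟩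
    rw [hs n i (hI i hi) c hc, hs n c hc i (hI i hi)]
    exact h7 i hi
  exact ⟨s, ⟨inferInstance, hord, hext.isUniversal, hext.isHomogeneous⟩,
    fun x y ⟨n, hn⟩ => (u n).le x y hn⟩

end StrictPoset

theorem mainTheorem9 {A : Type*} [Countable A] (r : A → A → Prop) [IsStrictOrder A r] :
    StrictPoset.IsPolymorphismHomogeneous r ↔
      IsAntichain r Set.univ ∨ StrictPoset.IsExtensionOfU r := by
  constructor
  · intro h
    by_cases hr : ∃ a b, r a b
    · obtain ⟨a, b, hab⟩ := hr
      have hi := h.hasInterpolation hab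
      exact Or.inr ⟨hi.isOrderExtensionOfU, hi.isX5Dense⟩
    · exact Or.inl fun a _ b _ _ hab => hr ⟨a, b, hab⟩
  · rintro (h | h)
    · exact StrictPoset.isPolymorphismHomogeneous_of_isAntichain h
    · exact h.hasInterpolation.isPolymorphismHomogeneous
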